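/- Let $\mathbb F$ be the category of finite sets with its cartesian structure, $\mathbb S$ the category of sets, and $[\mathbb F,\mathbb S]$ the category of functors $\mathbb F\to\mathbb S$ with the monoidal structure given by Day convolution with respect to $\times$ (so $(F\star G)(X)\cong\int^{C}F(C)\times G(C\to X)$, where $C\to X$ denotes the exponential, and the unit is the inclusion of finite sets into sets). A *strong endoprofunctor* is a functor $P:\mathbb F^{\mathrm{op}}\times\mathbb F\to\mathbb S$ with maps $\mathrm{str}_{X,Y,Z}:P(X,Y)\to P(X\times Z,Y\times Z)$, natural in $X,Y$ and dinatural in $Z$, such that $P(\mathrm{id},\pi_1)\circ\mathrm{str}_{X,Y,1}=P(\pi_1,\mathrm{id})$ and $\mathrm{str}_{X\times V,Y\times V,W}\circ\mathrm{str}_{X,Y,V}=P(\alpha^{-1},\alpha)\circ\mathrm{str}_{X,Y,V\times W}$, where $\alpha:A\times(V\times W)\cong(A\times V)\times W$. With the natural transformations that commute with the strengths these form a category $\mathrm{Prof}_s$. It is monoidal with tensor $(P\otimes Q)(X,Y)=\int^{W}P(X,W)\times Q(W,Y)$, whose strength is induced by those of $P$ and $Q$, and unit $\mathrm{Hom}$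 with strength $f\mapsto f\times\mathrm{id}$. Monoids in $\mathrm{Prof}_s$ are called arrows; for an arrow write $\mathrm{arr}$ for its unit, $\ggg$ for its multiplication and $\mathrm{first}$ for its strength. The functor $L:[\mathbb F,\mathbb S]\to\mathrm{Prof}_s$, $L F(X,Y)=F(X\to Y)$, with strength induced by $k\mapsto k\times\mathrm{id}$, is left adjoint to $R:\mathrm{Prof}_s\to[\mathbb F,\mathbb S]$, $R P(Z)=P(1,Z)$. Let $\Box=LR$ be the induced idempotent comonad on $\mathrm{Prof}_s$, so $\Box P(X,Y)=P(1,X\to Y)$. Let $\mathrm{Mon}(\Box)$ be the category of $\Box$-monoids: its objects are monoids in $\mathrm{Prof}_s$ together with a $\Box$-coalgebra structure on the underlying object, and its morphisms are the morphisms that are both monoid morphisms and coalgebra morphisms. **Theorem.** The categories $\mathrm{Mon}([\mathbb F,\mathbb S])$ and $\mathrm{Mon}(\Box)$ are equivalent, by an equivalence that is given on underlying objects, up to natural isomorphism, by $L$, with inverse given on underlying objects, up to natural isomorphism, by $R$. Moreover, the forgetful functor $\mathrm{Mon}(\Box)\to\mathrm{Mon}(\mathrm{Prof}_s)$ is fully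 faithful, and an arrow $P$ lies in its essential image if and only if, for all finite sets $A,B$, the map $$\mathrm{force}:P(1,A\to B)\to P(A,B),\qquad \mathrm{force}(f)=\mathrm{arr}(x\mapsto((),x))\ggg\mathrm{first}(f)\ggg\mathrm{arr}((k,a)\mapsto k(a))$$ is bijective. -/

import Mathlib

open CategoryTheory MonoidalCategory Limits Opposite

universe u

namespace IdiomArrow

noncomputable section

/-! ### Finite sets with their cartesian monoidal structure -/

instance fintypeCat_essentiallySmall : EssentiallySmall.{u} FintypeCat.{u} :=
  EssentiallySmall.mk' FintypeCat.Skeleton.equivalence.symm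

instance prod_essentiallySmall {C D : Type*} [Category C] [Category D] [EssentiallySmall.{u} C]
    [EssentiallySmall.{u} D] : EssentiallySmall.{u} (C × D) :=
  EssentiallySmall.mk' ((equivSmallModel.{u} C).prod (equivSmallModel.{u} D))

instance type_hasColimitsOfShape {J : Type*} [Category J] [EssentiallySmall.{u} J] :
    HasColimitsOfShape J (Type u) :=
  hasColimitsOfShape_of_essentiallySmall.{u} J _

instance tensorRight_preservesColimits (V : Type u) {J : Type*} [Category J] :
    PreservesColimitsOfShape J (tensorRight V) :=
  preservesColimitsOfShape_of_natIso (BraidedCategory.tensorLeftIsoTensorRight V)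

/-- The category of finite sets with its cartesian monoidal structure: `X ⊗ Y` is the set of
pairs and `𝟙_` is the one-point set. -/
instance fintypeCartesian : CartesianMonoidalCategory FintypeCat.{u} :=
  .ofChosenFiniteProducts
    ⟨asEmptyCone (FintypeCat.of PUnit.{u + 1}),
      IsTerminal.ofUniqueHom (fun _ => FintypeCat.homMk fun _ => PUnit.unit)
        (fun _ _ => by ext)⟩
    (fun X Y =>
      ⟨BinaryFan.mk (P := FintypeCat.of (X.obj × Y.obj))
          (FintypeCat.homMk Prod.fst) (FintypeCat.homMk Prod.snd),
        BinaryFan.IsLimit.mk _ (fun f g => FintypeCat.homMk fun t => (f t, g t))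
          (fun f g => by ext; rfl) (fun f g => by ext; rfl)
          (fun f g m h1 h2 => by subst h1 h2; rfl)⟩)

/-- The exponential `X → Y` of finite sets. -/
abbrev expo (X Y : FintypeCat.{u}) : FintypeCat.{u} := FintypeCat.of (X.obj → Y.obj)

/-- Functoriality of the exponential. -/
abbrev expoMap {X X' Y Y' : FintypeCat.{u}} (f : X' ⟶ X) (g : Y ⟶ Y') :
    expo X Y ⟶ expo X' Y' :=
  FintypeCat.homMk fun (k : X.obj → Y.obj) (x : X'.obj) => g (k (f x))

/-- The evaluation `(X → Y) × X → Y`. -/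
abbrev ev (X Y : FintypeCat.{u}) : expo X Y ⊗ X ⟶ Y :=
  FintypeCat.homMk fun (p : (X.obj → Y.obj) × X.obj) => p.1 p.2

/-- The projection `X × Y → X`. -/
abbrev proj₁ (X Y : FintypeCat.{u}) : X ⊗ Y ⟶ X :=
  SemiCartesianMonoidalCategory.fst X Y

/-! ### Functors from finite sets to sets, with Day convolution -/

/-- The category `[𝔽, 𝕊]` of functors from finite sets to sets, with the monoidal structure
given by Day convolution with respect to the cartesian product of finite sets. -/
abbrev FinFunctor : Type (u + 1) := DayFunctor FintypeCat.{u} (Type u)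

/-! ### Strong endoprofunctors on finite sets -/

/-- Endoprofunctors on finite sets. -/
abbrev Endoprofunctor : Type (u + 1) := FintypeCat.{u}ᵒᵖ × FintypeCat.{u} ⥤ Type u

/-- The set `P(X, Y)`. -/
abbrev Endoprofunctor.at (P : Endoprofunctor.{u}) (X Y : FintypeCat.{u}) : Type u :=
  P.obj (op X, Y)

/-- The action `P(f, g) : P(X, Y) → P(X', Y')`. -/
def Endoprofunctor.dimap (P : Endoprofunctor.{u}) {X X' Y Y' : FintypeCat.{u}}
    (f : X' ⟶ X) (g : Y ⟶ Y') (p : P.at X Y) : P.at X' Y' :=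
  P.map (Prod.mkHom f.op g) p

@[simp]
theorem Endoprofunctor.dimap_id (P : Endoprofunctor.{u}) {X Y : FintypeCat.{u}} (p : P.at X Y) :
    P.dimap (𝟙 X) (𝟙 Y) p = p :=
  ConcreteCategory.congr_hom (P.map_id (op X, Y)) p

@[simp]
theorem Endoprofunctor.dimap_dimap (P : Endoprofunctor.{u}) {X X' X'' Y Y' Y'' : FintypeCat.{u}}
    (f : X' ⟶ X) (g : Y ⟶ Y') (f' : X'' ⟶ X') (g' : Y' ⟶ Y'') (p : P.at X Y) :
    P.dimap f' g' (P.dimap f g p) = P.dimap (f' ≫ f) (g ≫ g') p :=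
  (ConcreteCategory.congr_hom
    (P.map_comp (Prod.mkHom f.op g : (op X, Y) ⟶ (op X', Y')) (Prod.mkHom f'.op g')) p).symm

/-- A constructor for endoprofunctors from the sets `P(X, Y)` and the action of pairs of maps. -/
abbrev Endoprofunctor.ofDimap (obj : FintypeCat.{u} → FintypeCat.{u} → Type u)
    (dimap : ∀ {X X' Y Y' : FintypeCat.{u}}, (X' ⟶ X) → (Y ⟶ Y') → obj X Y → obj X' Y')
    (dimap_id : ∀ (X Y : FintypeCat.{u}) (p : obj X Y), dimap (𝟙 X) (𝟙 Y) p = p)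
    (dimap_comp : ∀ {X X' X'' Y Y' Y'' : FintypeCat.{u}} (f : X' ⟶ X) (g : Y ⟶ Y')
      (f' : X'' ⟶ X') (g' : Y' ⟶ Y'') (p : obj X Y),
      dimap (f' ≫ f) (g ≫ g') p = dimap f' g' (dimap f g p)) : Endoprofunctor.{u} where
  obj A := obj A.1.unop A.2
  map h := TypeCat.ofHom (dimap h.1.unop h.2)
  map_id A := by ext p; exact dimap_id _ _ p
  map_comp h k := by ext p; exact dimap_comp _ _ _ _ p

/-- A strong endoprofunctor on finite sets: an endoprofunctor `P` with a strength
`P(X, Y) → P(X × Z, Y × Z)`, natural in `X` and `Y` and dinatural in `Z`, compatible with the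
unit and the associativity of the cartesian product. -/
structure StrongProf : Type (u + 1) where
  /-- the underlying endoprofunctor -/
  P : Endoprofunctor.{u}
  /-- the strength -/
  str : ∀ {X Y : FintypeCat.{u}} (Z : FintypeCat.{u}), P.at X Y → P.at (X ⊗ Z) (Y ⊗ Z)
  str_natural : ∀ {X X' Y Y' : FintypeCat.{u}} (Z : FintypeCat.{u}) (f : X' ⟶ X) (g : Y ⟶ Y')
    (p : P.at X Y), str Z (P.dimap f g p) = P.dimap (f ▷ Z) (g ▷ Z) (str Z p)
  str_dinatural : ∀ {X Y Z Z' : FintypeCat.{u}} (h : Z ⟶ Z') (p : P.at X Y),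
    P.dimap (𝟙 (X ⊗ Z)) (Y ◁ h) (str Z p) = P.dimap (X ◁ h) (𝟙 (Y ⊗ Z')) (str Z' p)
  str_unit : ∀ {X Y : FintypeCat.{u}} (p : P.at X Y),
    P.dimap (𝟙 _) (proj₁ Y (𝟙_ _)) (str (𝟙_ _) p) = P.dimap (proj₁ X (𝟙_ _)) (𝟙 _) p
  str_assoc : ∀ {X Y : FintypeCat.{u}} (V W : FintypeCat.{u}) (p : P.at X Y),
    str W (str V p) = P.dimap (α_ X V W).hom (α_ Y V W).inv (str (V ⊗ W) p)

namespace StrongProf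

/-- Strong natural transformations. -/
@[ext]
structure Hom (P Q : StrongProf.{u}) where
  /-- the underlying natural transformation -/
  natTrans : P.P ⟶ Q.P
  comm_str : ∀ {X Y : FintypeCat.{u}} (Z : FintypeCat.{u}) (p : P.P.at X Y),
    natTrans.app (op (X ⊗ Z), Y ⊗ Z) (P.str Z p) = Q.str Z (natTrans.app (op X, Y) p)

instance category : Category StrongProf.{u} where
  Hom := Hom
  id P := { natTrans := 𝟙 P.P, comm_str := fun _ _ => rfl }
  comp σ τ :=
    { natTrans := σ.natTrans ≫ τ.natTrans
      comm_str := fun Z p => by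
        have h1 := σ.comm_str Z p
        have h2 := τ.comm_str Z (σ.natTrans.app _ p)
        exact (congrArg _ h1).trans h2 }

/-- The component `P(X, Y) → Q(X, Y)` of a strong natural transformation. -/
def app {P Q : StrongProf.{u}} (τ : P ⟶ Q) {X Y : FintypeCat.{u}} (p : P.P.at X Y) :
    Q.P.at X Y :=
  τ.natTrans.app (op X, Y) p

theorem hom_ext {P Q : StrongProf.{u}} {σ τ : P ⟶ Q}
    (h : ∀ (X Y : FintypeCat.{u}) (p : P.P.at X Y), app σ p = app τ p) : σ = τ := by
  apply Hom.ext
  ext A p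
  exact h A.1.unop A.2 p

@[simp]
theorem id_app (P : StrongProf.{u}) {X Y : FintypeCat.{u}} (p : P.P.at X Y) :
    app (𝟙 P) p = p := rfl

@[simp]
theorem comp_app {P Q T : StrongProf.{u}} (σ : P ⟶ Q) (τ : Q ⟶ T) {X Y : FintypeCat.{u}}
    (p : P.P.at X Y) : app (σ ≫ τ) p = app τ (app σ p) := rfl

theorem app_dimap {P Q : StrongProf.{u}} (τ : P ⟶ Q) {X X' Y Y' : FintypeCat.{u}}
    (f : X' ⟶ X) (g : Y ⟶ Y') (p : P.P.at X Y) :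
    app τ (P.P.dimap f g p) = Q.P.dimap f g (app τ p) :=
  ConcreteCategory.congr_hom (τ.natTrans.naturality (Prod.mkHom f.op g)) p

theorem app_str {P Q : StrongProf.{u}} (τ : P ⟶ Q) {X Y : FintypeCat.{u}}
    (Z : FintypeCat.{u}) (p : P.P.at X Y) : app τ (P.str Z p) = Q.str Z (app τ p) :=
  τ.comm_str Z p

/-- A constructor for strong natural transformations from their components. -/
def homMk {P Q : StrongProf.{u}} (t : ∀ X Y : FintypeCat.{u}, P.P.at X Y → Q.P.at X Y)
    (natural : ∀ ⦃X X' Y Y' : FintypeCat.{u}⦄ (f : X' ⟶ X) (g : Y ⟶ Y') (p : P.P.at X Y),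
      t X' Y' (P.P.dimap f g p) = Q.P.dimap f g (t X Y p))
    (strong : ∀ ⦃X Y : FintypeCat.{u}⦄ (Z : FintypeCat.{u}) (p : P.P.at X Y),
      t _ _ (P.str Z p) = Q.str Z (t X Y p)) : P ⟶ Q where
  natTrans :=
    { app := fun A => TypeCat.ofHom (t A.1.unop A.2)
      naturality := fun _ _ h => by ext p; exact natural h.1.unop h.2 p }
  comm_str := fun Z p => strong Z p

@[simp]
theorem homMk_app {P Q : StrongProf.{u}} (t : ∀ X Y : FintypeCat.{u}, P.P.at X Y → Q.P.at X Y)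
    (natural strong) {X Y : FintypeCat.{u}} (p : P.P.at X Y) :
    app (homMk (P := P) (Q := Q) t natural strong) p = t X Y p := rfl

/-! ### Bénabou's tensor -/

/-- The relation generating the coend `∫^W P(X, W) × Q(W, Y)`. -/
inductive CoendRel (P Q : Endoprofunctor.{u}) (X Y : FintypeCat.{u}) :
    (Σ W : FintypeCat.{u}, P.at X W × Q.at W Y) →
      (Σ W : FintypeCat.{u}, P.at X W × Q.at W Y) → Prop
  | glue {W W' : FintypeCat.{u}} (h : W ⟶ W') (p : P.at X W) (q : Q.at W' Y) :
      CoendRel P Q X Y ⟨W, p, Q.dimap h (𝟙 Y) q⟩ ⟨W', P.dimap (𝟙 X) h p, q⟩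

instance coend_small (P Q : Endoprofunctor.{u}) (X Y : FintypeCat.{u}) :
    Small.{u} (Quot (CoendRel P Q X Y)) := by
  refine small_of_surjective
    (α := Σ s : FintypeCat.Skeleton.{u}, P.at X (FintypeCat.Skeleton.incl.obj s) ×
      Q.at (FintypeCat.Skeleton.incl.obj s) Y)
    (f := fun a => Quot.mk _ ⟨FintypeCat.Skeleton.incl.obj a.1, a.2⟩) ?_
  rintro ⟨W, p, q⟩
  let e := FintypeCat.Skeleton.incl.objObjPreimageIso W
  refine ⟨⟨FintypeCat.Skeleton.incl.objPreimage W, P.dimap (𝟙 X) e.inv p,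
    Q.dimap e.hom (𝟙 Y) q⟩, ?_⟩
  refine (Quot.sound (CoendRel.glue e.hom (P.dimap (𝟙 X) e.inv p) q)).trans ?_
  simp

/-- The coend `∫^W P(X, W) × Q(W, Y)`, where `W` runs over all finite sets. -/
def Coend (P Q : Endoprofunctor.{u}) (X Y : FintypeCat.{u}) : Type u :=
  Shrink.{u} (Quot (CoendRel P Q X Y))

namespace Coend

variable {P Q : Endoprofunctor.{u}} {X Y : FintypeCat.{u}}

/-- The injection of `P(X, W) × Q(W, Y)` into the coend. -/
def ι (W : FintypeCat.{u}) (p : P.at X W) (q : Q.at W Y) : Coend P Q X Y :=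
  equivShrink _ (Quot.mk _ ⟨W, p, q⟩)

theorem ι_glue {W W' : FintypeCat.{u}} (h : W ⟶ W') (p : P.at X W) (q : Q.at W' Y) :
    (ι W p (Q.dimap h (𝟙 Y) q) : Coend P Q X Y) = ι W' (P.dimap (𝟙 X) h p) q :=
  congrArg (equivShrink _) (Quot.sound (CoendRel.glue h p q))

theorem ind {motive : Coend P Q X Y → Prop}
    (h : ∀ (W : FintypeCat.{u}) (p : P.at X W) (q : Q.at W Y), motive (ι W p q))
    (c : Coend P Q X Y) : motive c := by
  obtain ⟨a, rfl⟩ := (equivShrink _).surjective c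
  obtain ⟨W, p, q⟩ := a
  exact h W p q

/-- The map out of the coend induced by a family of maps that respects the relation. -/
def desc {T : Type*} (t : ∀ W : FintypeCat.{u}, P.at X W → Q.at W Y → T)
    (ht : ∀ ⦃W W' : FintypeCat.{u}⦄ (h : W ⟶ W') (p : P.at X W) (q : Q.at W' Y),
      t W p (Q.dimap h (𝟙 Y) q) = t W' (P.dimap (𝟙 X) h p) q)
    (c : Coend P Q X Y) : T :=
  Quot.lift (fun a => t a.1 a.2.1 a.2.2) (by rintro _ _ ⟨h, p, q⟩; exact ht h p q)
    ((equivShrink _).symm c)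

@[simp]
theorem desc_ι {T : Type*} (t : ∀ W : FintypeCat.{u}, P.at X W → Q.at W Y → T)
    (ht : ∀ ⦃W W' : FintypeCat.{u}⦄ (h : W ⟶ W') (p : P.at X W) (q : Q.at W' Y),
      t W p (Q.dimap h (𝟙 Y) q) = t W' (P.dimap (𝟙 X) h p) q)
    (W : FintypeCat.{u}) (p : P.at X W) (q : Q.at W Y) : desc t ht (ι W p q) = t W p q := by
  simp [desc, ι]

/-- The action of maps on the coend. -/
def dimap {X' Y' : FintypeCat.{u}} (f : X' ⟶ X) (g : Y ⟶ Y') :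
    Coend P Q X Y → Coend P Q X' Y' :=
  desc (fun W p q => ι W (P.dimap f (𝟙 W) p) (Q.dimap (𝟙 W) g q)) (fun _ _ h p q => by
    have := ι_glue h (P.dimap f (𝟙 _) p) (Q.dimap (𝟙 _) g q)
    simpa using this)

@[simp]
theorem dimap_ι {X' Y' : FintypeCat.{u}} (f : X' ⟶ X) (g : Y ⟶ Y')
    (W : FintypeCat.{u}) (p : P.at X W) (q : Q.at W Y) :
    dimap f g (ι W p q) = ι W (P.dimap f (𝟙 W) p) (Q.dimap (𝟙 W) g q) := by
  simp [dimap]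

end Coend

/-- The composite endoprofunctor `(X, Y) ↦ ∫^W P(X, W) × Q(W, Y)`. -/
abbrev comp (P Q : Endoprofunctor.{u}) : Endoprofunctor.{u} :=
  Endoprofunctor.ofDimap (Coend P Q) Coend.dimap
    (fun X Y c => by
      induction c using Coend.ind with
      | h W p q => simp)
    (fun f g f' g' c => by
      induction c using Coend.ind with
      | h W p q => simp)

theorem comp_dimap (P Q : Endoprofunctor.{u}) {X X' Y Y' : FintypeCat.{u}}
    (f : X' ⟶ X) (g : Y ⟶ Y') (c : Coend P Q X Y) :
    (comp P Q).dimap f g c = Coend.dimap f g c := rfl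

/-- The strength of the composite: `ι_W (p, q) ↦ ι_{W × Z} (str p, str q)`. -/
def compStr (P Q : StrongProf.{u}) {X Y : FintypeCat.{u}} (Z : FintypeCat.{u}) :
    Coend P.P Q.P X Y → Coend P.P Q.P (X ⊗ Z) (Y ⊗ Z) :=
  Coend.desc (fun W p q => Coend.ι (W ⊗ Z) (P.str Z p) (Q.str Z q)) (fun _ _ h p q => by
    have := Coend.ι_glue (h ▷ Z) (P.str Z p) (Q.str Z q)
    simpa [StrongProf.str_natural] using this)

@[simp]
theorem compStr_ι (P Q : StrongProf.{u}) {X Y : FintypeCat.{u}} (Z W : FintypeCat.{u})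
    (p : P.P.at X W) (q : Q.P.at W Y) :
    compStr P Q Z (Coend.ι W p q) = Coend.ι (W ⊗ Z) (P.str Z p) (Q.str Z q) := by
  simp [compStr]

/-- The tensor product of strong endoprofunctors. -/
def tensor (P Q : StrongProf.{u}) : StrongProf.{u} where
  P := comp P.P Q.P
  str Z := compStr P Q Z
  str_natural Z f g c := by
    induction c using Coend.ind with
    | h W p q => simp [comp_dimap, StrongProf.str_natural]
  str_dinatural {X Y Z Z'} h c := by
    induction c using Coend.ind with
    | h W p q =>
      simp only [comp_dimap, compStr_ι, Coend.dimap_ι]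
      simp only [Endoprofunctor.dimap_id, StrongProf.str_dinatural]
      rw [Coend.ι_glue, StrongProf.str_dinatural]
  str_unit c := by
    induction c using Coend.ind with
    | h W p q =>
      simp only [comp_dimap, compStr_ι, Coend.dimap_ι]
      simp only [Endoprofunctor.dimap_id, StrongProf.str_unit]
      rw [Coend.ι_glue, StrongProf.str_unit]
  str_assoc V W c := by
    induction c using Coend.ind with
    | h U p q =>
      simp only [comp_dimap, compStr_ι, Coend.dimap_ι, StrongProf.str_assoc]
      have := Coend.ι_glue (α_ U V W).hom
        (P.P.dimap (α_ _ V W).hom (α_ U V W).inv (P.str (V ⊗ W) p))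
        (Q.P.dimap (𝟙 _) (α_ _ V W).inv (Q.str (V ⊗ W) q))
      simpa using this

/-- The injection `P(X, W) × Q(W, Y) → (P ⊗ Q)(X, Y)`. -/
def tι {P Q : StrongProf.{u}} {X Y : FintypeCat.{u}} (W : FintypeCat.{u})
    (p : P.P.at X W) (q : Q.P.at W Y) : (tensor P Q).P.at X Y :=
  Coend.ι W p q

theorem tι_glue {P Q : StrongProf.{u}} {X Y W W' : FintypeCat.{u}} (h : W ⟶ W')
    (p : P.P.at X W) (q : Q.P.at W' Y) :
    (tι W p (Q.P.dimap h (𝟙 Y) q) : (tensor P Q).P.at X Y) = tι W' (P.P.dimap (𝟙 X) h p) q :=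
  Coend.ι_glue h p q

theorem tensor_ind {P Q : StrongProf.{u}} {X Y : FintypeCat.{u}}
    {motive : (tensor P Q).P.at X Y → Prop}
    (h : ∀ (W : FintypeCat.{u}) (p : P.P.at X W) (q : Q.P.at W Y), motive (tι W p q))
    (c : (tensor P Q).P.at X Y) : motive c :=
  Coend.ind h c

@[simp]
theorem tensor_dimap {P Q : StrongProf.{u}} {X X' Y Y' : FintypeCat.{u}}
    (f : X' ⟶ X) (g : Y ⟶ Y') (W : FintypeCat.{u}) (p : P.P.at X W) (q : Q.P.at W Y) :
    (tensor P Q).P.dimap f g (tι W p q) = tι W (P.P.dimap f (𝟙 W) p) (Q.P.dimap (𝟙 W) g q) :=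
  Coend.dimap_ι f g W p q

@[simp]
theorem tensor_str {P Q : StrongProf.{u}} {X Y : FintypeCat.{u}} (Z W : FintypeCat.{u})
    (p : P.P.at X W) (q : Q.P.at W Y) :
    (tensor P Q).str Z (tι W p q) = tι (W ⊗ Z) (P.str Z p) (Q.str Z q) :=
  compStr_ι P Q Z W p q

/-- A constructor for strong natural transformations out of a tensor product. -/
def tensorDesc {P Q T : StrongProf.{u}}
    (t : ∀ (X Y W : FintypeCat.{u}), P.P.at X W → Q.P.at W Y → T.P.at X Y)
    (ht : ∀ ⦃X Y W W' : FintypeCat.{u}⦄ (h : W ⟶ W') (p : P.P.at X W) (q : Q.P.at W' Y),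
      t X Y W p (Q.P.dimap h (𝟙 Y) q) = t X Y W' (P.P.dimap (𝟙 X) h p) q)
    (natural : ∀ ⦃X X' Y Y' W : FintypeCat.{u}⦄ (f : X' ⟶ X) (g : Y ⟶ Y') (p : P.P.at X W)
      (q : Q.P.at W Y), t X' Y' W (P.P.dimap f (𝟙 W) p) (Q.P.dimap (𝟙 W) g q) =
        T.P.dimap f g (t X Y W p q))
    (strong : ∀ ⦃X Y W : FintypeCat.{u}⦄ (Z : FintypeCat.{u}) (p : P.P.at X W) (q : Q.P.at W Y),
      t (X ⊗ Z) (Y ⊗ Z) (W ⊗ Z) (P.str Z p) (Q.str Z q) = T.str Z (t X Y W p q)) :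
    tensor P Q ⟶ T :=
  homMk (fun X Y => Coend.desc (t X Y) (ht (X := X) (Y := Y)))
    (fun _ _ _ _ f g c => by
      induction c using tensor_ind with
      | h W p q =>
        rw [tensor_dimap]
        exact (Coend.desc_ι _ _ _ _ _).trans
          ((natural f g p q).trans (congrArg _ (Coend.desc_ι _ _ _ _ _).symm)))
    (fun _ _ Z c => by
      induction c using tensor_ind with
      | h W p q =>
        rw [tensor_str]
        exact (Coend.desc_ι _ _ _ _ _).trans
          ((strong Z p q).trans (congrArg _ (Coend.desc_ι _ _ _ _ _).symm)))

@[simp]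
theorem tensorDesc_app {P Q T : StrongProf.{u}}
    (t : ∀ (X Y W : FintypeCat.{u}), P.P.at X W → Q.P.at W Y → T.P.at X Y)
    (ht : ∀ ⦃X Y W W' : FintypeCat.{u}⦄ (h : W ⟶ W') (p : P.P.at X W) (q : Q.P.at W' Y),
      t X Y W p (Q.P.dimap h (𝟙 Y) q) = t X Y W' (P.P.dimap (𝟙 X) h p) q)
    (natural strong) {X Y W : FintypeCat.{u}} (p : P.P.at X W) (q : Q.P.at W Y) :
    app (tensorDesc (T := T) t ht natural strong) (tι W p q) = t X Y W p q :=
  Coend.desc_ι (t X Y) (ht (X := X) (Y := Y)) W p q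

theorem tensor_hom_ext {P Q T : StrongProf.{u}} {σ τ : tensor P Q ⟶ T}
    (h : ∀ (X Y W : FintypeCat.{u}) (p : P.P.at X W) (q : Q.P.at W Y),
      app σ (tι W p q) = app τ (tι W p q)) : σ = τ :=
  hom_ext fun X Y c => by
    induction c using tensor_ind with
    | h W p q => exact h X Y W p q

/-- The unit `(X, Y) ↦ Hom(X, Y)`, with strength `f ↦ f × id`. -/
def unit : StrongProf.{u} where
  P := Endoprofunctor.ofDimap (fun X Y => X ⟶ Y) (fun f g k => f ≫ k ≫ g)
    (fun _ _ _ => by simp) (fun _ _ _ _ _ => by simp)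
  str Z k := k ▷ Z
  str_natural Z f g k := by
    change (f ≫ k ≫ g) ▷ Z = f ▷ Z ≫ k ▷ Z ≫ g ▷ Z
    simp
  str_dinatural h k := by
    change 𝟙 _ ≫ k ▷ _ ≫ _ ◁ h = _ ◁ h ≫ k ▷ _ ≫ 𝟙 _
    simp [whisker_exchange]
  str_unit k := rfl
  str_assoc V W k := rfl

/-- The action of the tensor product on morphisms. -/
def tensorMap {P P' Q Q' : StrongProf.{u}} (σ : P ⟶ P') (τ : Q ⟶ Q') :
    tensor P Q ⟶ tensor P' Q' :=
  tensorDesc (fun _ _ W p q => tι W (app σ p) (app τ q))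
    (fun _ _ _ _ h p q => by rw [app_dimap, tι_glue, app_dimap])
    (fun _ _ _ _ _ f g p q => by simp [app_dimap])
    (fun _ _ _ Z p q => by simp [app_str])

@[simp]
theorem tensorMap_app {P P' Q Q' : StrongProf.{u}} (σ : P ⟶ P') (τ : Q ⟶ Q')
    {X Y W : FintypeCat.{u}} (p : P.P.at X W) (q : Q.P.at W Y) :
    app (tensorMap σ τ) (tι W p q) = tι W (app σ p) (app τ q) :=
  tensorDesc_app _ _ _ _ _ _

/-- A map of finite sets as an element of the unit. -/
def ofMap {X Y : FintypeCat.{u}} (k : X ⟶ Y) : unit.P.at X Y := k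

/-- An element of the unit as a map of finite sets. -/
def toMap {X Y : FintypeCat.{u}} (k : unit.P.at X Y) : X ⟶ Y := k

@[simp]
theorem ofMap_toMap {X Y : FintypeCat.{u}} (k : unit.P.at X Y) : ofMap (toMap k) = k := rfl

@[simp]
theorem toMap_ofMap {X Y : FintypeCat.{u}} (k : X ⟶ Y) : toMap (ofMap k) = k := rfl

@[simp]
theorem toMap_dimap {X X' Y Y' : FintypeCat.{u}} (f : X' ⟶ X) (g : Y ⟶ Y')
    (k : unit.P.at X Y) : toMap (unit.P.dimap f g k) = f ≫ toMap k ≫ g := rfl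

@[simp]
theorem dimap_ofMap {X X' Y Y' : FintypeCat.{u}} (f : X' ⟶ X) (g : Y ⟶ Y')
    (k : X ⟶ Y) : unit.P.dimap f g (ofMap k) = ofMap (f ≫ k ≫ g) := rfl

@[simp]
theorem toMap_str {X Y : FintypeCat.{u}} (Z : FintypeCat.{u}) (k : unit.P.at X Y) :
    toMap (unit.str Z k) = toMap k ▷ Z := rfl

@[simp]
theorem str_ofMap {X Y : FintypeCat.{u}} (Z : FintypeCat.{u}) (k : X ⟶ Y) :
    unit.str Z (ofMap k) = ofMap (k ▷ Z) := rfl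

/-- The map `ι_W (k, q) ↦ P(k, id) q`. -/
def leftUnitHom (P : StrongProf.{u}) : tensor unit P ⟶ P :=
  tensorDesc (fun _ Y _ k q => P.P.dimap (toMap k) (𝟙 Y) q)
    (fun _ _ _ _ h k q => by simp)
    (fun _ _ _ _ _ f g k q => by simp)
    (fun _ _ _ Z k q => by simp [P.str_natural])

@[simp]
theorem leftUnitHom_app (P : StrongProf.{u}) {X Y W : FintypeCat.{u}} (k : unit.P.at X W)
    (q : P.P.at W Y) : app (leftUnitHom P) (tι W k q) = P.P.dimap (toMap k) (𝟙 Y) q :=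
  tensorDesc_app _ _ _ _ _ _

/-- The left unitor. -/
def leftUnit (P : StrongProf.{u}) : tensor unit P ≅ P where
  hom := leftUnitHom P
  inv := homMk (fun X _ p => tι X (ofMap (𝟙 X)) p)
    (fun X X' Y Y' f g p => by
      have := tι_glue (P := unit) (Q := P) f (ofMap (𝟙 X')) (P.P.dimap (𝟙 X) g p)
      simpa using this)
    (fun X Y Z p => by simp)
  hom_inv_id := tensor_hom_ext fun X Y W k q => by
    have := tι_glue (P := unit) (Q := P) (toMap k) (ofMap (𝟙 X)) q
    simpa using this
  inv_hom_id := hom_ext fun X Y p => by simp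

/-- The map `ι_W (p, k) ↦ P(id, k) p`. -/
def rightUnitHom (P : StrongProf.{u}) : tensor P unit ⟶ P :=
  tensorDesc (fun X _ _ p k => P.P.dimap (𝟙 X) (toMap k) p)
    (fun _ _ _ _ h p k => by simp)
    (fun _ _ _ _ _ f g p k => by simp)
    (fun _ _ _ Z p k => by simp [P.str_natural])

@[simp]
theorem rightUnitHom_app (P : StrongProf.{u}) {X Y W : FintypeCat.{u}} (p : P.P.at X W)
    (k : unit.P.at W Y) : app (rightUnitHom P) (tι W p k) = P.P.dimap (𝟙 X) (toMap k) p :=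
  tensorDesc_app _ _ _ _ _ _

/-- The right unitor. -/
def rightUnit (P : StrongProf.{u}) : tensor P unit ≅ P where
  hom := rightUnitHom P
  inv := homMk (fun _ Y p => tι Y p (ofMap (𝟙 Y)))
    (fun X X' Y Y' f g p => by
      have := tι_glue (P := P) (Q := unit) g (P.P.dimap f (𝟙 Y) p) (ofMap (𝟙 Y'))
      simpa using this.symm)
    (fun X Y Z p => by simp)
  hom_inv_id := tensor_hom_ext fun X Y W p k => by
    have := tι_glue (P := P) (Q := unit) (toMap k) p (ofMap (𝟙 Y))
    simpa using this.symm
  inv_hom_id := hom_ext fun X Y p => by simp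

/-- The associator `ι_V (ι_W (p, q), r) ↦ ι_W (p, ι_V (q, r))`. -/
def assoc (P Q T : StrongProf.{u}) : tensor (tensor P Q) T ≅ tensor P (tensor Q T) where
  hom := tensorDesc
    (fun X Y V c r => Coend.desc (T := (tensor P (tensor Q T)).P.at X Y)
      (fun W p q => tι W p (tι V q r))
      (fun _ _ h p q => by
        have := tι_glue (Q := tensor Q T) h p (tι V q r)
        simpa using this) c)
    (fun _ _ _ _ h c r => by
      induction c using tensor_ind with
      | h W p q =>
        rw [tensor_dimap, tι, tι, Coend.desc_ι, Coend.desc_ι, tι_glue]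
        simp)
    (fun _ _ _ _ _ f g c r => by
      induction c using tensor_ind with
      | h W p q =>
        rw [tensor_dimap, tι, tι, Coend.desc_ι, Coend.desc_ι]
        simp)
    (fun _ _ _ Z c r => by
      induction c using tensor_ind with
      | h W p q =>
        rw [tensor_str, tι, tι, Coend.desc_ι, Coend.desc_ι]
        simp)
  inv := tensorDesc
    (fun X Y W p c => Coend.desc (T := (tensor (tensor P Q) T).P.at X Y)
      (fun V q r => tι V (tι W p q) r)
      (fun _ _ h q r => by
        have := tι_glue (P := tensor P Q) h (tι W p q) r
        simpa using this) c)
    (fun _ _ _ _ h p c => by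
      induction c using tensor_ind with
      | h V q r =>
        rw [tensor_dimap, tι, tι, Coend.desc_ι, Coend.desc_ι, ← tι_glue]
        simp)
    (fun _ _ _ _ _ f g p c => by
      induction c using tensor_ind with
      | h V q r =>
        rw [tensor_dimap, tι, tι, Coend.desc_ι, Coend.desc_ι]
        simp)
    (fun _ _ _ Z p c => by
      induction c using tensor_ind with
      | h V q r =>
        rw [tensor_str, tι, tι, Coend.desc_ι, Coend.desc_ι]
        simp)
  hom_inv_id := tensor_hom_ext fun X Y V c r => by
    induction c using tensor_ind with
    | h W p q =>
      rw [comp_app, tensorDesc_app, tι, Coend.desc_ι, tensorDesc_app, tι, Coend.desc_ι]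
      rfl
  inv_hom_id := tensor_hom_ext fun X Y W p c => by
    induction c using tensor_ind with
    | h V q r =>
      rw [comp_app, tensorDesc_app, tι, Coend.desc_ι, tensorDesc_app, tι, Coend.desc_ι]
      rfl

@[simp]
theorem leftUnit_app (P : StrongProf.{u}) {X Y W : FintypeCat.{u}} (k : unit.P.at X W)
    (q : P.P.at W Y) : app (leftUnit P).hom (tι W k q) = P.P.dimap (toMap k) (𝟙 Y) q :=
  leftUnitHom_app P k q

@[simp]
theorem rightUnit_app (P : StrongProf.{u}) {X Y W : FintypeCat.{u}} (p : P.P.at X W)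
    (k : unit.P.at W Y) : app (rightUnit P).hom (tι W p k) = P.P.dimap (𝟙 X) (toMap k) p :=
  rightUnitHom_app P p k

@[simp]
theorem assoc_app (P Q T : StrongProf.{u}) {X Y V W : FintypeCat.{u}} (p : P.P.at X W)
    (q : Q.P.at W V) (r : T.P.at V Y) :
    app (assoc P Q T).hom (tι V (tι W p q) r) = tι W p (tι V q r) := by
  rw [assoc, tensorDesc_app, tι, Coend.desc_ι]

theorem leftUnit_naturality {P Q : StrongProf.{u}} (f : P ⟶ Q) {X Y W : FintypeCat.{u}}
    (k : unit.P.at X W) (q : P.P.at W Y) :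
    app (leftUnit Q).hom (app (tensorMap (𝟙 unit) f) (tι W k q)) =
      app f (app (leftUnit P).hom (tι W k q)) := by
  simp [app_dimap]

theorem rightUnit_naturality {P Q : StrongProf.{u}} (f : P ⟶ Q) {X Y W : FintypeCat.{u}}
    (p : P.P.at X W) (k : unit.P.at W Y) :
    app (rightUnit Q).hom (app (tensorMap f (𝟙 unit)) (tι W p k)) =
      app f (app (rightUnit P).hom (tι W p k)) := by
  simp [app_dimap]

theorem triangle_aux {P Q : StrongProf.{u}} {X Y V W : FintypeCat.{u}}
    (p : P.P.at X W) (k : unit.P.at W V) (q : Q.P.at V Y) :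
    app (tensorMap (𝟙 P) (leftUnit Q).hom) (app (assoc P unit Q).hom (tι V (tι W p k) q)) =
      app (tensorMap (rightUnit P).hom (𝟙 Q)) (tι V (tι W p k) q) := by
  simp [tι_glue]

/-- The category of strong endoprofunctors with Bénabou's tensor. -/
instance monoidal : MonoidalCategory StrongProf.{u} :=
  letI : MonoidalCategoryStruct StrongProf.{u} :=
    { tensorObj := tensor
      tensorUnit := unit
      tensorHom := tensorMap
      whiskerLeft := fun P _ _ τ => tensorMap (𝟙 P) τ
      whiskerRight := fun σ Q => tensorMap σ (𝟙 Q)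
      associator := assoc
      leftUnitor := leftUnit
      rightUnitor := rightUnit }
  .ofTensorHom
    (id_tensorHom_id := fun P Q => tensor_hom_ext fun X Y W p q => tensorMap_app _ _ _ _)
    (id_tensorHom := fun _ _ _ _ => rfl)
    (tensorHom_id := fun _ _ => rfl)
    (tensorHom_comp_tensorHom := fun f g h k => tensor_hom_ext fun X Y W p q => by
      change app (tensorMap h k) (app (tensorMap f g) (tι W p q)) =
        app (tensorMap (f ≫ h) (g ≫ k)) (tι W p q)
      simp)
    (associator_naturality := fun f g h => tensor_hom_ext fun X Y V c r => by
      induction c using tensor_ind with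
      | h W p q =>
        change app (assoc _ _ _).hom (app (tensorMap (tensorMap f g) h) (tι V (tι W p q) r)) =
          app (tensorMap f (tensorMap g h)) (app (assoc _ _ _).hom (tι V (tι W p q) r))
        simp)
    (leftUnitor_naturality := fun f => tensor_hom_ext fun X Y W k q => by
      exact leftUnit_naturality f k q)
    (rightUnitor_naturality := fun f => tensor_hom_ext fun X Y W p k => by
      exact rightUnit_naturality f p k)
    (pentagon := fun A B C D => tensor_hom_ext fun X Y V c r => by
      induction c using tensor_ind with
      | h W c q =>
        induction c using tensor_ind with
        | h U a b =>
          change app (tensorMap (𝟙 A) (assoc B C D).hom) (app (assoc A (tensor B C) D).hom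
              (app (tensorMap (assoc A B C).hom (𝟙 D)) (tι V (tι W (tι U a b) q) r))) =
            app (assoc A B (tensor C D)).hom (app (assoc (tensor A B) C D).hom
              (tι V (tι W (tι U a b) q) r))
          simp)
    (triangle := fun A B => tensor_hom_ext fun X Y V c r => by
      induction c using tensor_ind with
      | h W p k =>
        exact triangle_aux p k r)

end StrongProf

/-! ### The Cayley adjunction -/

/-- The functor `P ↦ P(1, -)`. -/
def star : StrongProf.{u} ⥤ FinFunctor.{u} where
  obj P :=
    { functor :=
        { obj := fun Z => P.P.at (𝟙_ _) Z
          map := fun g => TypeCat.ofHom (P.P.dimap (𝟙 _) g)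
          map_id := fun Z => by ext p; exact P.P.dimap_id p
          map_comp := fun f g => by
            ext p
            exact (P.P.dimap_dimap (𝟙 _) f (𝟙 _) g p).symm } }
  map τ :=
    { natTrans :=
        { app := fun Z => TypeCat.ofHom fun p => StrongProf.app τ p
          naturality := fun _ _ g => by ext p; exact StrongProf.app_dimap τ (𝟙 _) g p } }

/-- The map `(X → Y) → (X × Z → Y × Z)` sending `k` to `k × id`. -/
abbrev expoStr (X Y Z : FintypeCat.{u}) : expo X Y ⟶ expo (X ⊗ Z) (Y ⊗ Z) :=
  FintypeCat.homMk fun (k : X.obj → Y.obj) (a : X.obj × Z.obj) => (k a.1, a.2)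

/-- The strong endoprofunctor `(X, Y) ↦ F(X → Y)`, whose strength is induced by
`k ↦ ((x, z) ↦ (k x, z))`. -/
def cayleyObj (F : FinFunctor.{u}) : StrongProf.{u} where
  P := Endoprofunctor.ofDimap (fun X Y => F.functor.obj (expo X Y))
    (fun f g => F.functor.map (expoMap f g))
    (fun X Y p => ConcreteCategory.congr_hom (F.functor.map_id (expo X Y)) p)
    (fun f g f' g' p => ConcreteCategory.congr_hom
      (F.functor.map_comp (expoMap f g) (expoMap f' g')) p)
  str {X Y} Z := F.functor.map (expoStr X Y Z)
  str_natural Z f g p := by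
    refine (ConcreteCategory.congr_hom (F.functor.map_comp _ _) p).symm.trans
      (Eq.trans ?_ (ConcreteCategory.congr_hom (F.functor.map_comp _ _) p))
    rfl
  str_dinatural h p := by
    refine (ConcreteCategory.congr_hom (F.functor.map_comp _ _) p).symm.trans
      (Eq.trans ?_ (ConcreteCategory.congr_hom (F.functor.map_comp _ _) p))
    rfl
  str_unit p := by
    refine (ConcreteCategory.congr_hom (F.functor.map_comp _ _) p).symm.trans ?_
    rfl
  str_assoc V W p := by
    refine (ConcreteCategory.congr_hom (F.functor.map_comp _ _) p).symm.trans
      (Eq.trans ?_ (ConcreteCategory.congr_hom (F.functor.map_comp _ _) p))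
    rfl

/-- The Cayley functor `F ↦ ((X, Y) ↦ F(X → Y))`. -/
def cayley : FinFunctor.{u} ⥤ StrongProf.{u} where
  obj := cayleyObj
  map {F G} τ := StrongProf.homMk (P := cayleyObj F) (Q := cayleyObj G)
    (fun X Y => τ.natTrans.app (expo X Y))
    (fun _ _ _ _ f g p => ConcreteCategory.congr_hom (τ.natTrans.naturality (expoMap f g)) p)
    (fun X Y Z p => ConcreteCategory.congr_hom (τ.natTrans.naturality (expoStr X Y Z)) p)
  map_id _ := StrongProf.hom_ext fun _ _ _ => rfl
  map_comp _ _ := StrongProf.hom_ext fun _ _ _ => rfl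

/-- The map `P(1, X → Y) → P(X, Y)` given by `P(λ⁻¹, ev) ∘ str`. -/
def counitMap (P : StrongProf.{u}) (X Y : FintypeCat.{u}) (p : P.P.at (𝟙_ _) (expo X Y)) :
    P.P.at X Y :=
  P.P.dimap (λ_ X).inv (ev X Y) (P.str X p)

theorem counitMap_natural (P : StrongProf.{u}) {X X' Y Y' : FintypeCat.{u}} (f : X' ⟶ X)
    (g : Y ⟶ Y') (p : P.P.at (𝟙_ _) (expo X Y)) :
    counitMap P X' Y' (P.P.dimap (𝟙 _) (expoMap f g) p) = P.P.dimap f g (counitMap P X Y p) := by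
  have h := congrArg (P.P.dimap (λ_ X').inv (ev X Y ≫ g)) (P.str_dinatural f p)
  rw [counitMap, counitMap, P.str_natural]
  simp only [Endoprofunctor.dimap_dimap] at h ⊢
  exact h

theorem counitMap_str (P : StrongProf.{u}) {X Y : FintypeCat.{u}} (Z : FintypeCat.{u})
    (p : P.P.at (𝟙_ _) (expo X Y)) :
    counitMap P (X ⊗ Z) (Y ⊗ Z) (P.P.dimap (𝟙 _) (expoStr X Y Z) p) =
      P.str Z (counitMap P X Y p) := by
  rw [counitMap, counitMap, P.str_natural, P.str_natural, P.str_assoc]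
  simp only [Endoprofunctor.dimap_dimap]
  rfl

theorem counitMap_app {P Q : StrongProf.{u}} (τ : P ⟶ Q) {X Y : FintypeCat.{u}}
    (p : P.P.at (𝟙_ _) (expo X Y)) :
    counitMap Q X Y (StrongProf.app τ p) = StrongProf.app τ (counitMap P X Y p) := by
  rw [counitMap, counitMap, StrongProf.app_dimap, StrongProf.app_str]

/-- The map `Z → (1 → Z)`. -/
abbrev const (Z : FintypeCat.{u}) : Z ⟶ expo (𝟙_ _) Z :=
  FintypeCat.homMk fun (z : Z.obj) (_ : PUnit) => z

theorem counitMap_const (P : StrongProf.{u}) {Z : FintypeCat.{u}} (p : P.P.at (𝟙_ _) Z) :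
    counitMap P (𝟙_ _) Z (P.P.dimap (𝟙 _) (const Z) p) = p := by
  rw [counitMap, P.str_natural]
  have h := congrArg (P.P.dimap (λ_ (𝟙_ FintypeCat.{u})).inv (𝟙 Z)) (P.str_unit p)
  simp only [Endoprofunctor.dimap_dimap] at h ⊢
  exact h.trans (P.P.dimap_id p)

/-- The counit of the Cayley adjunction. -/
def cayleyCounit (P : StrongProf.{u}) : cayley.obj (star.obj P) ⟶ P :=
  StrongProf.homMk (P := cayleyObj (star.obj P)) (counitMap P)
    (fun _ _ _ _ f g p => counitMap_natural P f g p)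
    (fun _ _ Z p => counitMap_str P Z p)

/-- The unit of the Cayley adjunction. -/
def cayleyUnit (F : FinFunctor.{u}) : F ⟶ star.obj (cayley.obj F) where
  natTrans :=
    { app := fun Z => F.functor.map (const Z)
      naturality := fun _ _ g => by
        refine (F.functor.map_comp _ _).symm.trans (Eq.trans ?_ (F.functor.map_comp _ _))
        rfl }

theorem cayley_triangle (F : FinFunctor.{u}) {X Y : FintypeCat.{u}}
    (p : F.functor.obj (expo X Y)) :
    counitMap (cayleyObj F) X Y (F.functor.map (const (expo X Y)) p) = p := by
  refine (ConcreteCategory.congr_hom (F.functor.map_comp _ _) _).symm.trans ?_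
  refine (ConcreteCategory.congr_hom (F.functor.map_comp _ _) _).symm.trans ?_
  exact ConcreteCategory.congr_hom (F.functor.map_id (expo X Y)) p

/-- The Cayley adjunction, with unit `F(curry ρ)` and counit `P(λ⁻¹, ev) ∘ str`. -/
def cayleyAdjunction : cayley.{u} ⊣ star.{u} :=
  Adjunction.mkOfUnitCounit
    { unit :=
        { app := cayleyUnit
          naturality := fun F G τ => by
            apply DayFunctor.hom_ext
            ext Z p
            exact (ConcreteCategory.congr_hom (τ.natTrans.naturality (const Z)) p).symm }
      counit :=
        { app := cayleyCounit
          naturality := fun P Q τ => StrongProf.hom_ext fun X Y p => counitMap_app τ p }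
      left_triangle := by
        ext F
        exact StrongProf.hom_ext fun X Y p => cayley_triangle F p
      right_triangle := by
        ext P Z p
        exact counitMap_const P p }

/-- The comonad `□ P = ((X, Y) ↦ P(1, X → Y))` on strong endoprofunctors. -/
def box : Comonad StrongProf.{u} := cayleyAdjunction.toComonad

instance cayleyUnit_isIso : IsIso cayleyAdjunction.{u}.unit := by
  have : ∀ F : FinFunctor.{u}, IsIso (cayleyAdjunction.unit.app F) := fun F =>
    ⟨{ natTrans :=
        { app := fun Z => F.functor.map (X := expo (𝟙_ _) Z)
            (FintypeCat.homMk fun (k : PUnit → Z.obj) => k PUnit.unit)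
          naturality := fun _ _ g => by
            refine (F.functor.map_comp _ _).symm.trans (Eq.trans ?_ (F.functor.map_comp _ _))
            rfl } },
      by
        apply DayFunctor.hom_ext
        ext Z : 2
        exact (F.functor.map_comp _ _).symm.trans (F.functor.map_id Z),
      by
        apply DayFunctor.hom_ext
        ext Z : 2
        exact (F.functor.map_comp _ _).symm.trans (F.functor.map_id (expo (𝟙_ _) Z))⟩
  exact NatIso.isIso_of_isIso_app _

/-- The comonad `□` is idempotent. -/
instance box_idempotent : IsIso box.{u}.δ := by
  have : ∀ P, IsIso (box.{u}.δ.app P) := fun P =>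
    inferInstanceAs (IsIso (cayley.map (cayleyAdjunction.unit.app (star.obj P))))
  exact NatIso.isIso_of_isIso_app _

/-! ### Monoids that are coalgebras for an idempotent comonad -/

/-- A `T`-monoid: a monoid `(M, m, e)` with a `T`-coalgebra structure `α : M → T M`. -/
structure ComonadMon {C : Type*} [Category C] [MonoidalCategory C] (T : Comonad C)
    [IsIso T.δ] where
  /-- the monoid -/
  mon : Mon C
  /-- the coalgebra structure -/
  α : mon.X ⟶ T.obj mon.X
  counit : α ≫ T.ε.app mon.X = 𝟙 mon.X
  coassoc : α ≫ T.δ.app mon.X = α ≫ T.map α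

namespace ComonadMon

variable {C : Type*} [Category C] [MonoidalCategory C] {T : Comonad C} [IsIso T.δ]

/-- Homomorphisms of `T`-monoids: monoid morphisms that are coalgebra morphisms. -/
@[ext]
structure Hom (M N : ComonadMon T) where
  /-- the underlying morphism of monoids -/
  hom : M.mon ⟶ N.mon
  comm : M.α ≫ T.map hom.hom = hom.hom ≫ N.α

instance category : Category (ComonadMon T) where
  Hom := Hom
  id M := { hom := 𝟙 M.mon, comm := by simp }
  comp f g :=
    { hom := f.hom ≫ g.hom
      comm := by
        have hf := f.comm
        have hg := g.comm
        simp [reassoc_of% hf, hg] }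

variable (T) in
/-- The functor that forgets the coalgebra structure. -/
def forgetToMon : ComonadMon T ⥤ Mon C where
  obj M := M.mon
  map f := f.hom

end ComonadMon

/-! ### Arrows and `force` -/

section Arrow

variable (M : Mon StrongProf.{u})

/-- The operation `arr` of an arrow. -/
def arr {A B : FintypeCat.{u}} (f : A ⟶ B) : M.X.P.at A B :=
  StrongProf.app (P := StrongProf.unit) (MonObj.one (X := M.X)) (StrongProf.ofMap f)

/-- The sequential composition `>>>` of an arrow. -/
def seq {A B C : FintypeCat.{u}} (p : M.X.P.at A B) (q : M.X.P.at B C) : M.X.P.at A C :=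
  StrongProf.app (P := StrongProf.tensor M.X M.X) (MonObj.mul (X := M.X)) (StrongProf.tι B p q)

/-- The operation `first` of an arrow. -/
def first {A B : FintypeCat.{u}} (C : FintypeCat.{u}) (p : M.X.P.at A B) :
    M.X.P.at (A ⊗ C) (B ⊗ C) :=
  M.X.str C p

/-- The map `force : P(1, A → B) → P(A, B)` of an arrow,
`force f = arr (x ↦ ((), x)) >>> first f >>> arr ((k, a) ↦ k a)`. -/
def force (A B : FintypeCat.{u}) (p : M.X.P.at (𝟙_ _) (expo A B)) : M.X.P.at A B :=
  seq M (seq M (arr M (λ_ A).inv) (first M A p)) (arr M (ev A B))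

end Arrow

end

end IdiomArrow

namespace IdiomArrow

noncomputable section

/-! ### Elements of Day convolutions -/

/-! Two independent facts are combined. The first is formal. Let `L ⊣ R` have invertible unit and
`L` strong monoidal. The induced comonad is idempotent, so a coalgebra structure on an object is the
inverse of the counit (`counit_comp_α`): it is unique, and every morphism preserves it
(`comm_of_mon`). Monoids with a coalgebra structure are therefore a full subcategory of all monoids,
namely those at which the counit is invertible, equivalently those whose underlying object lies in
the essential image of `L`. A strong monoidal fully faithful `L` lifts monoid structures from that
image, so the subcategory is equivalent to the monoids in the source
(`liftComonadMon_isEquivalence`). The second is that the Cayley functor is strong monoidal. Its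
tensorator `F(X → W) × G(W → Y) → (F ⋆ G)(X → Y)` composes functions. An element of `(F ⋆ G)(X → Y)`
is represented by `f : V × W → (X → Y)`, `p ∈ F V`, `q ∈ G W`. The inverse splits `f` through the
intermediate object `V × X`: first `x ↦ (v, x)`, then `(v, x) ↦ f (v, w) x` (`cayleyδ_app`).
Finally, the unit laws of an arrow turn composition with `arr` into the profunctor action, so
`force` is the counit of the adjunction (`force_eq_counitMap`), and invertibility of a strong
transformation is tested pointwise. -/

/-- Equal maps of sets agree on elements. -/
theorem typeHom_congr {S T : Type u} {f g : S ⟶ T} (h : f = g) (s : S) : f s = g s :=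
  h ▸ rfl

/-- The action of a functor `F : [𝔽, 𝕊]` on elements. -/
def FinFunctor.act (F : FinFunctor.{u}) {X Y : FintypeCat.{u}} (f : X ⟶ Y)
    (p : F.functor.obj X) : F.functor.obj Y :=
  F.functor.map f p

@[simp]
theorem FinFunctor.act_id (F : FinFunctor.{u}) {X : FintypeCat.{u}} (p : F.functor.obj X) :
    F.act (𝟙 X) p = p :=
  typeHom_congr (F.functor.map_id X) p

@[simp]
theorem FinFunctor.act_act (F : FinFunctor.{u}) {X Y Z : FintypeCat.{u}} (f : X ⟶ Y) (g : Y ⟶ Z)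
    (p : F.functor.obj X) : F.act g (F.act f p) = F.act (f ≫ g) p :=
  (typeHom_congr (F.functor.map_comp f g) p).symm

/-- The action of a morphism of `[𝔽, 𝕊]` on elements. -/
def dayApp {F G : FinFunctor.{u}} (τ : F ⟶ G) {X : FintypeCat.{u}} (p : F.functor.obj X) :
    G.functor.obj X :=
  τ.natTrans.app X p

@[simp]
theorem dayApp_act {F G : FinFunctor.{u}} (τ : F ⟶ G) {X Y : FintypeCat.{u}} (f : X ⟶ Y)
    (p : F.functor.obj X) : dayApp τ (F.act f p) = G.act f (dayApp τ p) :=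
  typeHom_congr (τ.natTrans.naturality f) p

/-- The element of the Day convolution given by a pair of elements. -/
def pair {F G : FinFunctor.{u}} {X Y : FintypeCat.{u}} (p : F.functor.obj X)
    (q : G.functor.obj Y) : (F ⊗ G).functor.obj (X ⊗ Y) :=
  (DayFunctor.η F G).app (X, Y) (p, q)

theorem pair_act {F G : FinFunctor.{u}} {X X' Y Y' : FintypeCat.{u}} (f : X ⟶ X') (g : Y ⟶ Y')
    (p : F.functor.obj X) (q : G.functor.obj Y) :
    pair (F.act f p) (G.act g q) = (F ⊗ G).act (f ⊗ₘ g) (pair p q) :=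
  typeHom_congr ((DayFunctor.η F G).naturality (X := (X, Y)) (Y := (X', Y'))
    (Prod.mkHom f g)) (p, q)

open LawfulDayConvolutionMonoidalCategoryStruct in
@[simp]
theorem dayApp_whiskerRight {F F' : FinFunctor.{u}} (σ : F ⟶ F') (G : FinFunctor.{u})
    {X Y : FintypeCat.{u}} (p : F.functor.obj X) (q : G.functor.obj Y) :
    dayApp (σ ▷ G) (pair p q) = pair (dayApp σ p) q :=
  typeHom_congr (convolutionExtensionUnit_comp_ι_map_whiskerRight_app
    FintypeCat.{u} (Type u) σ G X Y) (p, q)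

open LawfulDayConvolutionMonoidalCategoryStruct in
@[simp]
theorem dayApp_whiskerLeft (F : FinFunctor.{u}) {G G' : FinFunctor.{u}} (τ : G ⟶ G')
    {X Y : FintypeCat.{u}} (p : F.functor.obj X) (q : G.functor.obj Y) :
    dayApp (F ◁ τ) (pair p q) = pair p (dayApp τ q) :=
  typeHom_congr (convolutionExtensionUnit_comp_ι_map_whiskerLeft_app
    (C := FintypeCat.{u}) (Type u) F τ X Y) (p, q)

open LawfulDayConvolutionMonoidalCategoryStruct in
@[simp]
theorem dayApp_associator {F G H : FinFunctor.{u}} {X Y Z : FintypeCat.{u}}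
    (p : F.functor.obj X) (q : G.functor.obj Y) (r : H.functor.obj Z) :
    dayApp (α_ F G H).hom (pair (pair p q) r) =
      (F ⊗ G ⊗ H).act (α_ X Y Z).inv (pair p (pair q r)) :=
  typeHom_congr (associator_hom_unit_unit (C := FintypeCat.{u}) (Type u) F G H X Y Z)
    ((p, q), r)

/-- The generating element of the unit for Day convolution. -/
def dayPoint : (𝟙_ FinFunctor.{u}).functor.obj (𝟙_ FintypeCat.{u}) :=
  DayFunctor.ν FintypeCat.{u} (Type u) PUnit.unit

open LawfulDayConvolutionMonoidalCategoryStruct in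
@[simp]
theorem dayApp_leftUnitor {F : FinFunctor.{u}} {X : FintypeCat.{u}} (p : F.functor.obj X) :
    dayApp (λ_ F).hom (pair dayPoint p) = F.act (λ_ X).inv p :=
  typeHom_congr (leftUnitor_hom_unit_app (C := FintypeCat.{u}) (Type u) F X)
    (PUnit.unit, p)

open LawfulDayConvolutionMonoidalCategoryStruct in
@[simp]
theorem dayApp_rightUnitor {F : FinFunctor.{u}} {X : FintypeCat.{u}} (p : F.functor.obj X) :
    dayApp (ρ_ F).hom (pair p dayPoint) = F.act (ρ_ X).inv p :=
  typeHom_congr (rightUnitor_hom_unit_app (C := FintypeCat.{u}) (Type u) F X)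
    (p, PUnit.unit)

-- Day convolution is a pointwise left Kan extension, so its value at `Z` is a colimit of sets over
-- the maps `X ⊗ Y ⟶ Z`, and every element of such a colimit has a representative. This permits
-- checking identities on Day convolutions on pairs.
open LawfulDayConvolutionMonoidalCategoryStruct in
theorem exists_act_pair {F G : FinFunctor.{u}} {Z : FintypeCat.{u}} (t : (F ⊗ G).functor.obj Z) :
    ∃ (X Y : FintypeCat.{u}) (f : X ⊗ Y ⟶ Z) (p : F.functor.obj X) (q : G.functor.obj Y),
      (F ⊗ G).act f (pair p q) = t := by
  obtain ⟨j, ⟨p, q⟩, h⟩ := Types.jointly_surjective_of_isColimit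
    (isPointwiseLeftKanExtensionConvolutionExtensionUnit (C := FintypeCat.{u}) (V := Type u) F G Z) t
  exact ⟨j.left.1, j.left.2, j.hom, p, q, h⟩

-- The same argument for the unit, which is the left Kan extension of the one-point set along the
-- inclusion of the unit object.
open LawfulDayConvolutionMonoidalCategoryStruct in
theorem exists_act_dayPoint {Z : FintypeCat.{u}} (t : (𝟙_ FinFunctor.{u}).functor.obj Z) :
    ∃ f : 𝟙_ FintypeCat.{u} ⟶ Z, (𝟙_ FinFunctor.{u}).act f dayPoint = t := by
  obtain ⟨j, ⟨⟩, h⟩ := Types.jointly_surjective_of_isColimit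
    (isPointwiseLeftKanExtensionUnitUnit FintypeCat.{u} (Type u) FinFunctor.{u} Z) t
  exact ⟨j.hom, h⟩

/-- The morphism out of a Day convolution induced by a natural family of pairings. -/
def dayDesc {F G H : FinFunctor.{u}}
    (t : ∀ X Y : FintypeCat.{u}, F.functor.obj X → G.functor.obj Y → H.functor.obj (X ⊗ Y))
    (ht : ∀ ⦃X X' Y Y' : FintypeCat.{u}⦄ (f : X ⟶ X') (g : Y ⟶ Y') (p : F.functor.obj X)
      (q : G.functor.obj Y), t X' Y' (F.act f p) (G.act g q) = H.act (f ⊗ₘ g) (t X Y p q)) :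
    F ⊗ G ⟶ H :=
  DayFunctor.tensorDesc
    { app := fun A => TypeCat.ofHom fun a => t A.1 A.2 a.1 a.2
      naturality := fun _ _ h => by ext a; exact ht h.1 h.2 a.1 a.2 }

@[simp]
theorem dayApp_dayDesc {F G H : FinFunctor.{u}}
    (t : ∀ X Y : FintypeCat.{u}, F.functor.obj X → G.functor.obj Y → H.functor.obj (X ⊗ Y)) (ht)
    {X Y : FintypeCat.{u}} (p : F.functor.obj X) (q : G.functor.obj Y) :
    dayApp (dayDesc t ht) (pair p q) = t X Y p q :=
  typeHom_congr (DayFunctor.η_comp_tensorDesc_app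
    (F := F) (G := G) (H := H) _ X Y) (p, q)

/-- The morphism out of the unit for Day convolution induced by an element. -/
def dayUnitDesc {F : FinFunctor.{u}} (p : F.functor.obj (𝟙_ FintypeCat.{u})) : 𝟙_ FinFunctor.{u} ⟶ F :=
  DayFunctor.unitDesc (TypeCat.ofHom fun _ => p)

@[simp]
theorem dayApp_dayUnitDesc {F : FinFunctor.{u}} (p : F.functor.obj (𝟙_ FintypeCat.{u})) :
    dayApp (dayUnitDesc p) dayPoint = p :=
  typeHom_congr (DayFunctor.ν_comp_unitDesc (C := FintypeCat.{u}) (V := Type u)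
    (F := F) (TypeCat.ofHom fun _ => p)) PUnit.unit

/-! ### Elements of the Cayley construction -/

/-- An element of `F(X → Y)` as an element of the Cayley endoprofunctor. -/
def toCayley {F : FinFunctor.{u}} {X Y : FintypeCat.{u}} (p : F.functor.obj (expo X Y)) :
    (cayleyObj F).P.at X Y := p

/-- An element of the Cayley endoprofunctor as an element of `F(X → Y)`. -/
def ofCayley {F : FinFunctor.{u}} {X Y : FintypeCat.{u}} (p : (cayleyObj F).P.at X Y) :
    F.functor.obj (expo X Y) := p

@[simp]
theorem ofCayley_toCayley {F : FinFunctor.{u}} {X Y : FintypeCat.{u}}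
    (p : F.functor.obj (expo X Y)) : ofCayley (toCayley p) = p := rfl

@[simp]
theorem dimap_toCayley {F : FinFunctor.{u}} {X X' Y Y' : FintypeCat.{u}} (f : X' ⟶ X)
    (g : Y ⟶ Y') (p : F.functor.obj (expo X Y)) :
    (cayleyObj F).P.dimap f g (toCayley p) = toCayley (F.act (expoMap f g) p) := rfl

@[simp]
theorem ofCayley_dimap {F : FinFunctor.{u}} {X X' Y Y' : FintypeCat.{u}} (f : X' ⟶ X)
    (g : Y ⟶ Y') (p : (cayleyObj F).P.at X Y) :
    ofCayley ((cayleyObj F).P.dimap f g p) = F.act (expoMap f g) (ofCayley p) := rfl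

@[simp]
theorem str_toCayley {F : FinFunctor.{u}} {X Y : FintypeCat.{u}} (Z : FintypeCat.{u})
    (p : F.functor.obj (expo X Y)) :
    (cayleyObj F).str Z (toCayley p) = toCayley (F.act (expoStr X Y Z) p) := rfl

@[simp]
theorem ofCayley_str {F : FinFunctor.{u}} {X Y : FintypeCat.{u}} (Z : FintypeCat.{u})
    (p : (cayleyObj F).P.at X Y) :
    ofCayley ((cayleyObj F).str Z p) = F.act (expoStr X Y Z) (ofCayley p) := rfl

/-- The action of the Cayley functor on morphisms. -/
def cayleyMap {F G : FinFunctor.{u}} (τ : F ⟶ G) : cayleyObj F ⟶ cayleyObj G := cayley.map τ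

@[simp]
theorem cayleyMap_app {F G : FinFunctor.{u}} (τ : F ⟶ G) {X Y : FintypeCat.{u}}
    (p : (cayleyObj F).P.at X Y) :
    StrongProf.app (cayleyMap τ) p = toCayley (dayApp τ (ofCayley p)) := rfl

/-- An element of `P(1, Z)` as an element of `star P`. -/
def toStar {P : StrongProf.{u}} {Z : FintypeCat.{u}} (p : P.P.at (𝟙_ _) Z) :
    (star.obj P).functor.obj Z := p

/-- An element of `star P` as an element of `P(1, Z)`. -/
def ofStar {P : StrongProf.{u}} {Z : FintypeCat.{u}} (p : (star.obj P).functor.obj Z) :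
    P.P.at (𝟙_ _) Z := p

@[simp]
theorem ofStar_toStar {P : StrongProf.{u}} {Z : FintypeCat.{u}} (p : P.P.at (𝟙_ _) Z) :
    ofStar (toStar p) = p := rfl

@[simp]
theorem act_toStar {P : StrongProf.{u}} {Y Z : FintypeCat.{u}} (f : Y ⟶ Z)
    (p : P.P.at (𝟙_ _) Y) : (star.obj P).act f (toStar p) = toStar (P.P.dimap (𝟙 _) f p) := rfl

/-! ### The Cayley functor is strong monoidal -/

theorem pair_act_left {F G : FinFunctor.{u}} {X X' Y : FintypeCat.{u}} (f : X ⟶ X')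
    (p : F.functor.obj X) (q : G.functor.obj Y) :
    pair (F.act f p) q = (F ⊗ G).act (f ▷ Y) (pair p q) := by
  have := pair_act f (𝟙 Y) p q
  simpa using this

theorem pair_act_right {F G : FinFunctor.{u}} {X Y Y' : FintypeCat.{u}} (g : Y ⟶ Y')
    (p : F.functor.obj X) (q : G.functor.obj Y) :
    pair p (G.act g q) = (F ⊗ G).act (X ◁ g) (pair p q) := by
  have := pair_act (𝟙 X) g p q
  simpa using this

/-- The composition `(X → W) × (W → Y) → (X → Y)`. -/
abbrev expoComp (X W Y : FintypeCat.{u}) : expo X W ⊗ expo W Y ⟶ expo X Y :=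
  FintypeCat.homMk fun (k : (X.obj → W.obj) × (W.obj → Y.obj)) (x : X.obj) => k.2 (k.1 x)

/-- The element of `X → Y` that names a map. -/
abbrev expoName {X Y : FintypeCat.{u}} (k : X ⟶ Y) : 𝟙_ FintypeCat.{u} ⟶ expo X Y :=
  FintypeCat.homMk fun (_ : PUnit) (x : X.obj) => k x

/-- The tensorator `F(X → W) × G(W → Y) → (F ⊗ G)(X → Y)` of the Cayley functor. -/
def cayleyμ (F G : FinFunctor.{u}) :
    StrongProf.tensor (cayleyObj F) (cayleyObj G) ⟶ cayleyObj (F ⊗ G) :=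
  StrongProf.tensorDesc
    (fun X Y W p q => toCayley ((F ⊗ G).act (expoComp X W Y) (pair (ofCayley p) (ofCayley q))))
    (fun X Y W W' h p q => by
      rw [ofCayley_dimap, ofCayley_dimap, pair_act_left, pair_act_right, FinFunctor.act_act,
        FinFunctor.act_act]
      -- Both sides act on `pair` by `(k, l) ↦ l ∘ h ∘ k`.
      rfl)
    (fun X X' Y Y' W f g p q => by
      rw [ofCayley_dimap, ofCayley_dimap, dimap_toCayley, pair_act, FinFunctor.act_act,
        FinFunctor.act_act]
      rfl)
    (fun X Y W Z p q => by
      rw [ofCayley_str, ofCayley_str, str_toCayley, pair_act, FinFunctor.act_act,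
        FinFunctor.act_act]
      -- The composite of `k × id` and `l × id` is `(l ∘ k) × id`.
      rfl)

@[simp]
theorem cayleyμ_app {F G : FinFunctor.{u}} {X Y W : FintypeCat.{u}}
    (p : (cayleyObj F).P.at X W) (q : (cayleyObj G).P.at W Y) :
    StrongProf.app (cayleyμ F G) (StrongProf.tι W p q) =
      toCayley ((F ⊗ G).act (expoComp X W Y) (pair (ofCayley p) (ofCayley q))) :=
  StrongProf.tensorDesc_app _ _ _ _ _ _

/-- The unit comparison `Hom(X, Y) → I(X → Y)` of the Cayley functor. -/
def cayleyε : StrongProf.unit.{u} ⟶ cayleyObj (𝟙_ FinFunctor.{u}) :=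
  StrongProf.homMk
    (fun _ _ k => toCayley ((𝟙_ FinFunctor.{u}).act (expoName (StrongProf.toMap k)) dayPoint))
    (fun X X' Y Y' f g k => by
      rw [dimap_toCayley, FinFunctor.act_act]
      rfl)
    (fun X Y Z k => by
      rw [str_toCayley, FinFunctor.act_act]
      rfl)

@[simp]
theorem cayleyε_app {X Y : FintypeCat.{u}} (k : StrongProf.unit.P.at X Y) :
    StrongProf.app cayleyε k =
      toCayley ((𝟙_ FinFunctor.{u}).act (expoName (StrongProf.toMap k)) dayPoint) := rfl

-- Every axiom is checked on generators of the coend. Both sides then become the action of one map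
-- of finite sets on the same pair or triple, and these maps agree because composition of functions
-- is strictly associative and unital.
open StrongProf in
instance cayleyLaxMonoidal : cayley.{u}.LaxMonoidal where
  ε := cayleyε
  μ := cayleyμ
  μ_natural_left {F F'} σ G :=
    tensor_hom_ext (P := cayleyObj F) (Q := cayleyObj G) fun X Y W p q => by
      change app (cayleyμ F' G) (app (tensorMap (cayleyMap σ) (𝟙 (cayleyObj G))) (tι W p q)) =
        app (cayleyMap (σ ▷ G)) (app (cayleyμ F G) (tι W p q))
      simp
  μ_natural_right {G G'} F τ :=
    tensor_hom_ext (P := cayleyObj F) (Q := cayleyObj G) fun X Y W p q => by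
      change app (cayleyμ F G') (app (tensorMap (𝟙 (cayleyObj F)) (cayleyMap τ)) (tι W p q)) =
        app (cayleyMap (F ◁ τ)) (app (cayleyμ F G) (tι W p q))
      simp
  associativity F G H :=
    tensor_hom_ext (P := tensor (cayleyObj F) (cayleyObj G)) (Q := cayleyObj H)
      fun X Y V c r => by
        induction c using tensor_ind with
        | h W p q =>
          change app (cayleyMap (α_ F G H).hom) (app (cayleyμ (F ⊗ G) H)
              (app (tensorMap (cayleyμ F G) (𝟙 (cayleyObj H))) (tι V (tι W p q) r))) =
            app (cayleyμ F (G ⊗ H)) (app (tensorMap (𝟙 (cayleyObj F)) (cayleyμ G H))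
              (app (assoc (cayleyObj F) (cayleyObj G) (cayleyObj H)).hom (tι V (tι W p q) r)))
          simp only [assoc_app, tensorMap_app, cayleyμ_app, cayleyMap_app, ofCayley_toCayley,
            id_app, pair_act_left, pair_act_right, dayApp_act, dayApp_associator,
            FinFunctor.act_act]
          -- Both maps send `(k, (l, m))` to `m ∘ l ∘ k`.
          rfl
  left_unitality F :=
    tensor_hom_ext (P := unit) (Q := cayleyObj F) fun X Y W k q => by
      change app (leftUnit (cayleyObj F)).hom (tι W k q) =
        app (cayleyMap (λ_ F).hom) (app (cayleyμ (𝟙_ FinFunctor.{u}) F)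
          (app (tensorMap cayleyε (𝟙 (cayleyObj F))) (tι W k q)))
      simp only [leftUnit_app, tensorMap_app, cayleyμ_app, cayleyMap_app, cayleyε_app,
        ofCayley_toCayley, id_app, pair_act_left, dayApp_act, dayApp_leftUnitor,
        FinFunctor.act_act]
      rfl
  right_unitality F :=
    tensor_hom_ext (P := cayleyObj F) (Q := unit) fun X Y W p k => by
      change app (rightUnit (cayleyObj F)).hom (tι W p k) =
        app (cayleyMap (ρ_ F).hom) (app (cayleyμ F (𝟙_ FinFunctor.{u}))
          (app (tensorMap (𝟙 (cayleyObj F)) cayleyε) (tι W p k)))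
      simp only [rightUnit_app, tensorMap_app, cayleyμ_app, cayleyMap_app, cayleyε_app,
        ofCayley_toCayley, id_app, pair_act_right, dayApp_act, dayApp_rightUnitor,
        FinFunctor.act_act]
      rfl

/-! ### Invertibility of the tensorator and of the unit comparison -/

/-- The map `Y → (X → X × Y)`. -/
abbrev expoPair (X Y : FintypeCat.{u}) : Y ⟶ expo X (X ⊗ Y) :=
  FintypeCat.homMk fun (y : Y.obj) (x : X.obj) => ((x, y) : X.obj × Y.obj)

/-- The transpose of the inverse of the tensorator of the Cayley functor. -/
def cayleyδTranspose (F G : FinFunctor.{u}) :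
    F ⊗ G ⟶ star.obj (StrongProf.tensor (cayleyObj F) (cayleyObj G)) :=
  dayDesc
    -- The coend index is `X` itself: the first leg produces `x` from the point, the second takes
    -- `x` to `(x, y)`, so their composite names the pair.
    (fun X Y p q => toStar (StrongProf.tι X (toCayley (F.act (const X) p))
      (toCayley (G.act (expoPair X Y) q))))
    (fun X X' Y Y' f g p q => by
      -- The coend relation along `f` moves `f` from the second leg to the first.
      have h := StrongProf.tι_glue f (toCayley (F.act (const X) p))
        (toCayley (G.act (g ≫ expoPair X' Y') q))
      simp only [act_toStar, StrongProf.tensor_dimap, dimap_toCayley, FinFunctor.act_act] at h ⊢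
      exact congrArg toStar h.symm)

/-- The inverse of the tensorator of the Cayley functor. -/
def cayleyδ (F G : FinFunctor.{u}) :
    cayleyObj (F ⊗ G) ⟶ StrongProf.tensor (cayleyObj F) (cayleyObj G) :=
  cayley.map (cayleyδTranspose F G) ≫ cayleyCounit _

/-- The counit applies the strength with `X`, which enlarges the coend index from `V` to `V ⊗ X`:
the input `x` is carried beside `v` until `w` is available. Both inverse laws of the tensorator are
read off from this formula. -/
theorem cayleyδ_app {F G : FinFunctor.{u}} {X Y V W : FintypeCat.{u}} (f : V ⊗ W ⟶ expo X Y)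
    (p : F.functor.obj V) (q : G.functor.obj W) :
    StrongProf.app (cayleyδ F G) (toCayley ((F ⊗ G).act f (pair p q))) =
      StrongProf.tι (V ⊗ X)
        (toCayley (F.act
          (FintypeCat.homMk fun (v : V.obj) (x : X.obj) => ((v, x) : V.obj × X.obj)) p))
        (toCayley (G.act (FintypeCat.homMk fun (w : W.obj) (a : V.obj × X.obj) =>
          (f ((a.1, w) : V.obj × W.obj) : X.obj → Y.obj) a.2) q)) := by
  change counitMap (StrongProf.tensor (cayleyObj F) (cayleyObj G)) X Y
    (ofStar (dayApp (cayleyδTranspose F G) ((F ⊗ G).act f (pair p q)))) = _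
  rw [dayApp_act, cayleyδTranspose, dayApp_dayDesc, act_toStar, counitMap, ofStar_toStar]
  simp only [StrongProf.tensor_dimap, StrongProf.tensor_str, dimap_toCayley, str_toCayley,
    FinFunctor.act_act]
  rfl

instance cayleyμ_isIso (F G : FinFunctor.{u}) :
    IsIso (Functor.LaxMonoidal.μ cayley.{u} F G) := by
  refine ⟨cayleyδ F G,
    StrongProf.tensor_hom_ext (P := cayleyObj F) (Q := cayleyObj G) fun X Y W p q => ?_,
    StrongProf.hom_ext fun X Y t => ?_⟩
  · change StrongProf.app (cayleyδ F G) (StrongProf.app (cayleyμ F G)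
      (StrongProf.tι W p q)) = StrongProf.tι W p q
    rw [cayleyμ_app, cayleyδ_app]
    -- For `f = expoComp X W Y` the second leg is `q` precomposed with evaluation at index `(X → W)
    -- × X`. Gluing along `ev X W` moves the evaluation to the first leg, where `k ↦ (x ↦ (k, x))`
    -- followed by evaluation is the identity.
    refine (StrongProf.tι_glue (ev X W) _ q).trans ?_
    rw [dimap_toCayley, FinFunctor.act_act]
    exact congrArg (fun p => StrongProf.tι W (toCayley p) q) (FinFunctor.act_id F (ofCayley p))
  -- In this order no gluing is needed: composing the two legs gives back `f`.
  · obtain ⟨V, W, f, p, q, rfl⟩ := exists_act_pair (F := F) (G := G) (Z := expo X Y) t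
    change StrongProf.app (cayleyμ F G) (StrongProf.app (cayleyδ F G)
      (toCayley ((F ⊗ G).act f (pair p q)))) = toCayley ((F ⊗ G).act f (pair p q))
    rw [cayleyδ_app, cayleyμ_app, ofCayley_toCayley, ofCayley_toCayley, pair_act,
      FinFunctor.act_act]
    rfl

/-- The inverse of the unit comparison of the Cayley functor. -/
def cayleyη : cayleyObj (𝟙_ FinFunctor.{u}) ⟶ StrongProf.unit.{u} :=
  cayley.map (dayUnitDesc (toStar (StrongProf.ofMap (𝟙 (𝟙_ _))))) ≫ cayleyCounit _

theorem cayleyη_app {X Y : FintypeCat.{u}} (f : 𝟙_ FintypeCat.{u} ⟶ expo X Y) :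
    StrongProf.app cayleyη (toCayley ((𝟙_ FinFunctor.{u}).act f dayPoint)) =
      StrongProf.ofMap (FintypeCat.homMk fun x : X.obj => (f PUnit.unit : X.obj → Y.obj) x) := by
  change counitMap StrongProf.unit X Y (ofStar (dayApp (dayUnitDesc
    (toStar (StrongProf.ofMap (𝟙 (𝟙_ _))))) ((𝟙_ FinFunctor.{u}).act f dayPoint))) = _
  rw [dayApp_act, dayApp_dayUnitDesc]
  rfl

/-- Elements of the Day unit at `X → Y` come from points of the exponential, and these are the maps
`X ⟶ Y`. -/
instance cayleyε_isIso : IsIso (Functor.LaxMonoidal.ε cayley.{u}) := by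
  refine ⟨cayleyη, StrongProf.hom_ext (P := StrongProf.unit) fun X Y k => ?_,
    StrongProf.hom_ext fun X Y t => ?_⟩
  · change StrongProf.app cayleyη (StrongProf.app cayleyε k) = k
    rw [cayleyε_app, cayleyη_app]
    rfl
  · obtain ⟨f, rfl⟩ := exists_act_dayPoint (Z := expo X Y) t
    change StrongProf.app cayleyε (StrongProf.app cayleyη
      (toCayley ((𝟙_ FinFunctor.{u}).act f dayPoint))) =
        toCayley ((𝟙_ FinFunctor.{u}).act f dayPoint)
    rw [cayleyη_app, cayleyε_app]
    rfl

instance cayleyMonoidal : cayley.{u}.Monoidal :=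
  Functor.Monoidal.ofLaxMonoidal _

/-! ### Monoids with a coalgebra structure for an idempotent comonad -/

/-- Both are retractions of the comultiplication, which is invertible. -/
theorem comonad_map_counit {C : Type*} [Category C] (T : Comonad C) [IsIso T.δ] (X : C) :
    T.map (T.ε.app X) = T.ε.app (T.obj X) := by
  rw [← cancel_epi (T.δ.app X), T.right_counit, T.left_counit]

namespace ComonadMon

variable {C : Type*} [Category C] [MonoidalCategory C] {T : Comonad C} [IsIso T.δ]

/-- By naturality, `ε ≫ α` is `T α` followed by the counit at `T M`. That counit equals `T ε`, so
the composite is `T (α ≫ ε) = 𝟙`. Thus `α` is determined as the inverse of `ε`. -/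
theorem counit_comp_α (M : ComonadMon T) : T.ε.app M.mon.X ≫ M.α = 𝟙 _ := by
  have h := T.ε.naturality M.α
  simp only [Functor.id_map, Functor.id_obj] at h
  rw [← h, ← comonad_map_counit]
  erw [← T.map_comp, M.counit, T.map_id]

instance counit_isIso (M : ComonadMon T) : IsIso (T.ε.app M.mon.X) :=
  ⟨M.α, M.counit_comp_α, M.counit⟩

/-- A morphism of monoids is a morphism of coalgebras for an idempotent comonad. -/
theorem comm_of_mon {M N : ComonadMon T} (f : M.mon ⟶ N.mon) :
    M.α ≫ T.map f.hom = f.hom ≫ N.α := by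
  rw [← cancel_mono (T.ε.app N.mon.X), Category.assoc, Category.assoc, N.counit,
    T.ε.naturality, ← Category.assoc, M.counit]
  simp

variable (T) in
/-- The functor that forgets the coalgebra structure is fully faithful. -/
def fullyFaithfulForgetToMon : (forgetToMon T).FullyFaithful where
  preimage f := { hom := f, comm := comm_of_mon f }

instance forgetToMon_full : (forgetToMon T).Full := (fullyFaithfulForgetToMon T).full

instance forgetToMon_faithful : (forgetToMon T).Faithful := (fullyFaithfulForgetToMon T).faithful

/-- A monoid on which the counit is invertible is a `T`-monoid. -/
def ofIsIsoCounit (M : Mon C) [IsIso (T.ε.app M.X)] : ComonadMon T where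
  mon := M
  α := inv (T.ε.app M.X)
  counit := by simp
  coassoc := by
    -- After composing with the invertible map `T ε`, both sides reduce to `α`.
    rw [← cancel_mono (T.map (T.ε.app M.X)), Category.assoc, Category.assoc,
      T.right_counit, ← T.map_comp]
    simp

/-- Invertibility of the counit is invariant under isomorphism of the underlying object, and the
inverse of the counit is itself a coalgebra structure. -/
theorem essImage_forgetToMon_iff (M : Mon C) :
    (forgetToMon T).essImage M ↔ IsIso (T.ε.app M.X) := by
  constructor
  · rintro ⟨N, ⟨e⟩⟩
    have e' : N.mon.X ≅ M.X := (Mon.forget C).mapIso e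
    rw [← NatTrans.isIso_app_iff_of_iso T.ε e']
    infer_instance
  · intro h
    exact ⟨ofIsIsoCounit M, ⟨Iso.refl _⟩⟩

end ComonadMon

/-! ### The equivalence -/

section Lift

variable {C D : Type*} [Category* C] [Category* D] [MonoidalCategory C] [MonoidalCategory D]
  {L : C ⥤ D} {R : D ⥤ C} (adj : L ⊣ R) [L.Monoidal] [IsIso adj.unit] [IsIso adj.toComonad.δ]

/-- The functor from monoids to monoids with a coalgebra structure induced by a strong monoidal
fully faithful left adjoint. -/
def liftComonadMon : Mon C ⥤ ComonadMon adj.toComonad where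
  obj M :=
    haveI := adj.fullyFaithfulLOfIsIsoUnit.full
    haveI := adj.fullyFaithfulLOfIsIsoUnit.faithful
    -- As `L` is fully faithful, the counit is invertible on its image.
    haveI : IsIso (adj.toComonad.ε.app (L.mapMon.obj M).X) :=
      inferInstanceAs (IsIso (adj.counit.app (L.obj M.X)))
    ComonadMon.ofIsIsoCounit (L.mapMon.obj M)
  map f := (ComonadMon.fullyFaithfulForgetToMon _).preimage (L.mapMon.map f :)
  map_id M := (ComonadMon.forgetToMon _).map_injective (L.mapMon.map_id M)
  map_comp f g := (ComonadMon.forgetToMon _).map_injective (L.mapMon.map_comp f g)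

/-- Forgetting the coalgebra structure recovers the functor induced on monoids. -/
def liftComonadMonForget : liftComonadMon adj ⋙ ComonadMon.forgetToMon _ ≅ L.mapMon :=
  NatIso.ofComponents (fun M => Iso.refl (L.mapMon.obj M)) (fun f =>
    (Category.comp_id (L.mapMon.map f)).trans (Category.id_comp (L.mapMon.map f)).symm)

/-- Followed by the fully faithful forgetful functor it is `L.mapMon`, which is fully faithful
because `L` is; hence so is the lift. For essential surjectivity, the counit at a `T`-monoid is
invertible, so its underlying object is in the essential image of `L` and its monoid structure
lifts. -/
instance liftComonadMon_isEquivalence : (liftComonadMon adj).IsEquivalence := by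
  have := adj.fullyFaithfulLOfIsIsoUnit.full
  have := adj.fullyFaithfulLOfIsIsoUnit.faithful
  have hff : (liftComonadMon adj ⋙ ComonadMon.forgetToMon _).FullyFaithful :=
    adj.fullyFaithfulLOfIsIsoUnit.mapMon.ofIso (liftComonadMonForget adj).symm
  have hl : (liftComonadMon adj).FullyFaithful := hff.ofCompFaithful
  refine { faithful := hl.faithful, full := hl.full, essSurj := ⟨fun N => ?_⟩ }
  have h : IsIso (adj.counit.app N.mon.X) := N.counit_isIso
  obtain ⟨M, ⟨e⟩⟩ := (L.essImage_mapMon (M := N.mon)).2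
    (adj.isIso_counit_app_iff_mem_essImage.1 h)
  exact ⟨M, ⟨(ComonadMon.fullyFaithfulForgetToMon _).preimageIso
    ((liftComonadMonForget adj).app M ≪≫ e)⟩⟩

end Lift

/-! ### Arrows and `force` -/

/-- This is the right unit law of the monoid at the generator `ι_B (p, g)`, since the right unitor
is the action of `g` on `p`. -/
theorem seq_arr (M : Mon StrongProf.{u}) {A B C : FintypeCat.{u}} (p : M.X.P.at A B)
    (g : B ⟶ C) : seq M p (arr M g) = M.X.P.dimap (𝟙 A) g p := by
  have h := congrArg (fun τ => StrongProf.app (P := StrongProf.tensor M.X StrongProf.unit) τ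
    (StrongProf.tι B p (StrongProf.ofMap g))) (MonObj.mul_one M.X)
  have h2 : StrongProf.app (StrongProf.rightUnit M.X).hom
    (StrongProf.tι B p (StrongProf.ofMap g)) = _ := StrongProf.rightUnit_app M.X p _
  refine Eq.trans ?_ (h.trans h2)
  change _ = StrongProf.app (P := StrongProf.tensor M.X M.X) MonObj.mul
    (StrongProf.app (StrongProf.tensorMap (𝟙 M.X) MonObj.one) (StrongProf.tι B p _))
  erw [StrongProf.tensorMap_app]
  rfl

theorem arr_seq (M : Mon StrongProf.{u}) {A B C : FintypeCat.{u}} (f : A ⟶ B)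
    (p : M.X.P.at B C) : seq M (arr M f) p = M.X.P.dimap f (𝟙 C) p := by
  have h := congrArg (fun τ => StrongProf.app (P := StrongProf.tensor StrongProf.unit M.X) τ
    (StrongProf.tι B (StrongProf.ofMap f) p)) (MonObj.one_mul M.X)
  have h2 : StrongProf.app (StrongProf.leftUnit M.X).hom
    (StrongProf.tι B (StrongProf.ofMap f) p) = _ := StrongProf.leftUnit_app M.X _ p
  refine Eq.trans ?_ (h.trans h2)
  change _ = StrongProf.app (P := StrongProf.tensor M.X M.X) MonObj.mul
    (StrongProf.app (StrongProf.tensorMap MonObj.one (𝟙 M.X)) (StrongProf.tι B _ p))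
  erw [StrongProf.tensorMap_app]
  rfl

/-- The two outer `arr` factors become the action of `λ⁻¹` and `ev` on `first p`, which is the
formula for the counit. -/
theorem force_eq_counitMap (M : Mon StrongProf.{u}) (A B : FintypeCat.{u}) :
    force M A B = counitMap M.X A B := by
  funext p
  rw [force, seq_arr, arr_seq, Endoprofunctor.dimap_dimap]
  rfl

/-- Pointwise inverses of a strong natural transformation are again natural and strong: by
injectivity of `τ` the equations may be checked after applying `τ`. -/
theorem StrongProf.isIso_iff_bijective {P Q : StrongProf.{u}} (τ : P ⟶ Q) :
    IsIso τ ↔ ∀ X Y : FintypeCat.{u},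
      Function.Bijective (fun p : P.P.at X Y => StrongProf.app τ p) := by
  constructor
  · intro _ X Y
    refine Function.bijective_iff_has_inverse.2 ⟨fun q => app (inv τ) q, fun p => ?_, fun q => ?_⟩
    · change app (inv τ) (app τ p) = p
      rw [← comp_app, IsIso.hom_inv_id, id_app]
    · change app τ (app (inv τ) q) = q
      rw [← comp_app, IsIso.inv_hom_id, id_app]
  · intro h
    let e (X Y : FintypeCat.{u}) : P.P.at X Y ≃ Q.P.at X Y := Equiv.ofBijective _ (h X Y)
    have he (X Y : FintypeCat.{u}) (q : Q.P.at X Y) : app τ ((e X Y).symm q) = q :=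
      (e X Y).apply_symm_apply q
    refine ⟨homMk (P := Q) (Q := P) (fun X Y => (e X Y).symm)
      (fun X X' Y Y' f g q => (h X' Y').1 ?_) (fun X Y Z q => (h _ _).1 ?_),
      hom_ext fun X Y p => (e X Y).symm_apply_apply p, hom_ext fun X Y q => he X Y q⟩
    · change app τ _ = app τ _
      rw [app_dimap, he, he]
    · change app τ _ = app τ _
      rw [app_str, he, he]

/-- A monoid in strong endoprofunctors carries a coalgebra structure exactly when all of its maps
`force` are bijective. -/
theorem essImage_forgetToMon_iff_force (M : Mon StrongProf.{u}) :
    (ComonadMon.forgetToMon box.{u}).essImage M ↔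
      ∀ A B : FintypeCat.{u}, Function.Bijective (force M A B) := by
  rw [ComonadMon.essImage_forgetToMon_iff, StrongProf.isIso_iff_bijective]
  simp only [force_eq_counitMap]
  -- The counit of `box` at `M.X` is by definition `counitMap` in each component.
  rfl

/-! ### Application to the Cayley adjunction -/

instance : IsIso cayleyAdjunction.{u}.toComonad.δ := box_idempotent

/-- The equivalence between monoids for Day convolution and `□`-monoids. -/
def monEquivalence : Mon FinFunctor.{u} ≌ ComonadMon box.{u} :=
  (liftComonadMon cayleyAdjunction.{u}).asEquivalence

/-- The equivalence is given by the Cayley functor on underlying objects. -/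
def monEquivalenceFunctorIso :
    monEquivalence.{u}.functor ⋙ ComonadMon.forgetToMon box ⋙ Mon.forget StrongProf.{u} ≅
      Mon.forget FinFunctor.{u} ⋙ cayley :=
  Functor.isoWhiskerRight (liftComonadMonForget cayleyAdjunction.{u}) (Mon.forget StrongProf.{u})

/-- The inverse of the equivalence is given by `P ↦ P(1, -)` on underlying objects. -/
def monEquivalenceInverseIso :
    monEquivalence.{u}.inverse ⋙ Mon.forget FinFunctor.{u} ≅
      ComonadMon.forgetToMon box ⋙ Mon.forget StrongProf.{u} ⋙ star :=
  -- Let `M` be the monoid assigned to a `□`-monoid `N`. Then `M ≅ R L M` by the unit, `L M`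
  -- underlies the image of `M` under the equivalence, and that image is isomorphic to `N`.
  Functor.isoWhiskerLeft (monEquivalence.{u}.inverse ⋙ Mon.forget FinFunctor.{u})
      (asIso cayleyAdjunction.{u}.unit) ≪≫
    Functor.isoWhiskerLeft monEquivalence.{u}.inverse
      (Functor.isoWhiskerRight monEquivalenceFunctorIso.{u}.symm star) ≪≫
    Functor.isoWhiskerRight monEquivalence.{u}.counitIso
      (ComonadMon.forgetToMon box ⋙ Mon.forget StrongProf.{u} ⋙ star)

end

end IdiomArrow

open IdiomArrow in
theorem mainTheorem8 :
    (∃ e : Mon FinFunctor.{u} ≌ ComonadMon box.{u},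
      Nonempty (e.functor ⋙ ComonadMon.forgetToMon box ⋙ Mon.forget StrongProf.{u} ≅
        Mon.forget FinFunctor.{u} ⋙ cayley) ∧
      Nonempty (e.inverse ⋙ Mon.forget FinFunctor.{u} ≅
        ComonadMon.forgetToMon box ⋙ Mon.forget StrongProf.{u} ⋙ star)) ∧
    (ComonadMon.forgetToMon box.{u}).Full ∧
    (ComonadMon.forgetToMon box.{u}).Faithful ∧
    ∀ M : Mon StrongProf.{u},
      (ComonadMon.forgetToMon box.{u}).essImage M ↔
        ∀ A B : FintypeCat.{u}, Function.Bijective (force M A B) := by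
  exact ⟨⟨monEquivalence, ⟨monEquivalenceFunctorIso⟩, ⟨monEquivalenceInverseIso⟩⟩,
    inferInstance, inferInstance, essImage_forgetToMon_iff_force⟩
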